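/- Let $\mathbb{S}^1$ be a Euclidean circle in $\mathbb{R}^2$ (with any center and any radius $r>0$), and let $d(a,b)\in[0,\pi]$ be the angular distance on $\mathbb{S}^1$, i.e. the angle at the center between the radii to $a$ and $b$. For a continuous map $f\colon \mathbb{S}^1\to\mathbb{R}^2$, two distinct points $a,b\in\mathbb{S}^1$ are called visual $f$-neighbors if either $f(a)=f(b)$ or the segment with endpoints $f(a)$ and $f(b)$ intersects $f(\mathbb{S}^1)$ only at these two points. Put $$\Omega_f^{vis}=\{d(a,b) : a,b\in\mathbb{S}^1 \text{ are visual } f\text{-neighbors}\}.$$ Then for every $\varepsilon\in(0,\pi/3)$ there exists a continuous map $f_\varepsilon\colon\mathbb{S}^1\to\mathbb{R}^2$ such that $$\Omega_{f_\varepsilon}^{vis}=(0,\varepsilon]\cup\left[\tfrac{2\pi}{3}-\varepsilon,\,\pi\right].$$ -/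

import Mathlib

/-- Two distinct points `a`, `b` of `M` are visual `f`-neighbors if either `f a = f b` or the closed
segment with endpoints `f a` and `f b` meets the image of `f` only at these two points. -/
def AreVisualNeighbors {M : Type*} {m : ℕ} (f : M → EuclideanSpace ℝ (Fin m)) (a b : M) : Prop :=
  a ≠ b ∧ (f a = f b ∨ segment ℝ (f a) (f b) ∩ Set.range f = {f a, f b})

/-- The set of distances, with respect to the distance function `d` on `M`, that are realized by
pairs of visual `f`-neighbors. -/
def visualDistances {M : Type*} {m : ℕ} (d : M → M → ℝ)
    (f : M → EuclideanSpace ℝ (Fin m)) : Set ℝ :=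
  {t : ℝ | ∃ a b : M, AreVisualNeighbors f a b ∧ d a b = t}

/-- The angular distance on the circle with center `c` and radius `r` in the Euclidean plane: the
angle, in `[0, π]`, between the radii drawn to the two points. -/
noncomputable def angularDist (c : EuclideanSpace ℝ (Fin 2)) (r : ℝ)
    (a b : Metric.sphere c r) : ℝ :=
  EuclideanGeometry.angle (a : EuclideanSpace ℝ (Fin 2)) c (b : EuclideanSpace ℝ (Fin 2))

/-! If the image of a map is closed under midpoints, a segment between two distinct image points
contains a further image point, so visual neighbors are exactly the pairs of points with equal image
(`eq_of_areVisualNeighbors`). It therefore suffices to build a closed curve that fills a triangle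
and whose self-intersections occur exactly at the prescribed time lags. In the unit `π / 3` the
circle has length `6`, and with `2 * l = ε / (π / 3)` the lags must be `(0, 2l] ∪ [2 - 2l, 3]`
(`exists_convex_filling_loop`).

The lags near `2` and `3` come from a chart `(triFst, triSnd)` of the triangle by the strip `ℝ × [0,
1]`, `6`-periodic in the first variable. Height `0` runs around the boundary twice per period, so
boundary points recur after `3`. Over the unit intervals around `0`, `2`, `4`, increasing height
pushes the point inward, and each interval sweeps out one of the three sectors cut off by the rays
from the center to the vertices. Points of a ray are reached from two sectors, with lag `2` at the
center growing to `3` at the vertex. No shorter nonzero lag occurs (`eq_or_two_le_of_tri_eq`).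

The chart is composed with a strip-filling path `(G, Y)` satisfying `|G t - t| ≤ l`
(`exists_strip_filling_curve`). This changes lags by at most `2l`, which excludes all unwanted lags.
Conversely, the path rests over the center around each even integer, which realizes `(0, 2l]` and
`[2 - 2l, 2]`, and it visits mirror-symmetric positions on the two sides of a ray at suitable times,
which realizes `[2, 3]`. The path is a fine staircase with a space-filling loop on each step, run
through with a delay near the even integers. -/

/-! ### Periodic extension of functions. -/

/-- The representative of `t` modulo `p` in `[-p/2, p/2)`. -/
noncomputable def centeredMod (p t : ℝ) : ℝ := p * Int.fract (t / p + 1 / 2) - p / 2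

/-- The `p`-periodic function that agrees with `g` on `[-p/2, p/2)`. -/
noncomputable def periodize (p : ℝ) (g : ℝ → ℝ) (t : ℝ) : ℝ := g (centeredMod p t)

theorem continuous_periodize {p : ℝ} {g : ℝ → ℝ} (hg : Continuous g)
    (h : g (-(p / 2)) = g (p / 2)) : Continuous (periodize p g) := by
  have h1 : Continuous fun x : ℝ => (fun z => g (p * z - p / 2)) (Int.fract x) := by
    refine ContinuousOn.comp_fract'' (f := fun z => g (p * z - p / 2)) ?_ ?_
    · exact (by fun_prop : Continuous fun z => g (p * z - p / 2)).continuousOn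
    · simp only [mul_zero, mul_one, zero_sub]
      rw [h]; congr 1; ring
  exact h1.comp (by fun_prop : Continuous fun t : ℝ => t / p + 1 / 2)

theorem periodize_eq {p : ℝ} (hp : 0 < p) {g : ℝ → ℝ} (h : g (-(p / 2)) = g (p / 2)) {v t : ℝ}
    (k : ℤ) (hv : |v| ≤ p / 2) (ht : t = p * k + v) : periodize p g t = g v := by
  obtain ⟨h1, h2⟩ := abs_le.1 hv
  unfold periodize centeredMod
  have e : t / p + 1 / 2 = (v / p + 1 / 2) + (k : ℤ) := by
    rw [ht]; field_simp; ring
  rw [e, Int.fract_add_intCast]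
  rcases h2.eq_or_lt with h2 | h2
  · have : v / p + 1 / 2 = 1 := by rw [h2]; field_simp; norm_num
    rw [this, Int.fract_one, h2, ← h]; congr 1; ring
  · have : Int.fract (v / p + 1 / 2) = v / p + 1 / 2 := by
      rw [Int.fract_eq_self]
      have e1 : v / p + 1 / 2 = (v + p / 2) / p := by field_simp
      rw [e1]
      exact ⟨div_nonneg (by linarith) hp.le, (div_lt_one hp).2 (by linarith)⟩
    rw [this]; congr 1; field_simp; ring

theorem exists_int_mul_add {p : ℝ} (hp : 0 < p) (t : ℝ) :
    ∃ (k : ℤ) (v : ℝ), |v| ≤ p / 2 ∧ t = p * k + v := by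
  refine ⟨⌊t / p + 1 / 2⌋, centeredMod p t, ?_, ?_⟩
  · have h0 := Int.fract_nonneg (t / p + 1 / 2)
    have h1 := (Int.fract_lt_one (t / p + 1 / 2)).le
    rw [abs_le, centeredMod]
    constructor <;> nlinarith
  · have := Int.self_sub_floor (t / p + 1 / 2)
    rw [centeredMod, ← this]; field_simp; ring

theorem periodize_add {p : ℝ} (hp : 0 < p) (g : ℝ → ℝ) (t : ℝ) (k : ℤ) :
    periodize p g (t + p * k) = periodize p g t := by
  unfold periodize centeredMod
  have e : (t + p * k) / p + 1 / 2 = (t / p + 1 / 2) + (k : ℤ) := by field_simp; ring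
  rw [e, Int.fract_add_intCast]

/-! ### Space-filling loops and the staircase. -/

/-- A space-filling curve of the unit square. -/
theorem exists_continuous_surjOn_square :
    ∃ P : ℝ → unitInterval × unitInterval, Continuous P ∧ ∀ q, ∃ t ∈ Set.Icc (0 : ℝ) 1, P t = q := by
  -- An uncountable closed set contains a copy of the Cantor space, which surjects continuously onto
  -- the square. Tietze extension then gives a map on the whole line.
  have hnc : ¬ (Set.Icc (0 : ℝ) 1).Countable := by
    intro h
    have h1 := (Cardinal.le_aleph0_iff_set_countable).2 h
    rw [Cardinal.mk_Icc_real one_pos] at h1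
    exact absurd h1 (not_le.2 Cardinal.aleph0_lt_continuum)
  obtain ⟨e, heC, hec, hei⟩ := isClosed_Icc.exists_nat_bool_injection_of_not_countable hnc
  have hemb : Topology.IsClosedEmbedding e := hec.isClosedEmbedding hei
  obtain ⟨s, hs, hsurj⟩ :=
    exists_nat_bool_continuous_surjective_of_compact (unitInterval × unitInterval)
  obtain ⟨P, hP⟩ := ContinuousMap.exists_extension' hemb ⟨s, hs⟩
  refine ⟨P, P.continuous, fun q => ?_⟩
  obtain ⟨x, rfl⟩ := hsurj q
  exact ⟨e x, heC ⟨x, rfl⟩, congrFun hP x⟩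

/-- A loop based at `(0, 1)`, run through during `[-r, r]`, that fills the rectangle
`[-1/2, 1/2] × [0, 1]`. -/
theorem exists_loop_filling_rectangle {r : ℝ} (hr : 0 < r) :
    ∃ x y : ℝ → ℝ, Continuous x ∧ Continuous y ∧ (∀ v, |x v| ≤ 1 / 2) ∧
      (∀ v, y v ∈ Set.Icc (0 : ℝ) 1) ∧ (∀ v, r ≤ |v| → x v = 0 ∧ y v = 1) ∧
      ∀ a b : ℝ, |a| ≤ 1 / 2 → b ∈ Set.Icc (0 : ℝ) 1 → ∃ v, |v| ≤ r ∧ x v = a ∧ y v = b := by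
  obtain ⟨P, hPc, hPs⟩ := exists_continuous_surjOn_square
  -- Cutoff equal to `1` for `|v| ≤ r / 2` and to `0` for `|v| ≥ r`. It contracts the curve to `(0,
  -- 1)` outside the loop, while the square is already filled during `[0, r / 2]`.
  set c : ℝ → ℝ := fun v => max 0 (min 1 (2 - 2 * |v| / r)) with hc
  have hc0 : ∀ v, 0 ≤ c v := fun v => le_max_left _ _
  have hc1 : ∀ v, c v ≤ 1 := fun v => max_le zero_le_one (min_le_left _ _)
  have hcc : Continuous c := by fun_prop
  refine ⟨fun v => c v * ((P (v * (2 / r))).1 - 1 / 2), fun v => 1 - c v * (1 - (P (v * (2 / r))).2),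
    by fun_prop, by fun_prop, fun v => ?_, fun v => ?_, fun v hv => ?_, fun a b ha hb => ?_⟩
  · have h1 := (P (v * (2 / r))).1.2.1
    have h2 := (P (v * (2 / r))).1.2.2
    rw [abs_mul, abs_of_nonneg (hc0 v)]
    have : |((P (v * (2 / r))).1 : ℝ) - 1 / 2| ≤ 1 / 2 := by rw [abs_le]; constructor <;> linarith
    nlinarith [hc0 v, hc1 v, abs_nonneg (((P (v * (2 / r))).1 : ℝ) - 1 / 2)]
  · have h1 := (P (v * (2 / r))).2.2.1
    have h2 := (P (v * (2 / r))).2.2.2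
    have := hc0 v; have := hc1 v
    constructor <;> nlinarith
  · have : c v = 0 := by
      have : 1 ≤ |v| / r := (one_le_div hr).2 hv
      refine max_eq_left (min_le_of_right_le ?_)
      rw [mul_div_assoc]; linarith
    simp [this]
  · obtain ⟨t, ⟨ht0, ht1⟩, ht⟩ := hPs (⟨a + 1 / 2, by
      rw [abs_le] at ha; constructor <;> linarith⟩, ⟨b, hb⟩)
    have hv : |t * (r / 2)| = t * (r / 2) := abs_of_nonneg (by positivity)
    have hcv : c (t * (r / 2)) = 1 := by
      have : (2 : ℝ) - 2 * |t * (r / 2)| / r = 2 - t := by rw [hv]; field_simp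
      simp only [hc, this]
      rw [min_eq_left (by linarith), max_eq_right zero_le_one]
    have harg : t * (r / 2) * (2 / r) = t := by field_simp
    refine ⟨t * (r / 2), by rw [hv]; nlinarith, ?_, ?_⟩
    · simp only [hcv, harg, ht]; ring
    · simp only [hcv, harg, ht]; ring

/-- The odd function that vanishes on `[-1/4, 1/4]` and has slope `2` elsewhere. -/
noncomputable def stairStep (v : ℝ) : ℝ := max 0 (2 * v - 1 / 2) - max 0 (-(2 * v) - 1 / 2)

theorem stairStep_neg (v : ℝ) : stairStep (-v) = -stairStep v := by
  unfold stairStep; rw [show 2 * -v = -(2 * v) by ring, neg_neg]; ring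

theorem stairStep_eq_zero {v : ℝ} (h : |v| ≤ 1 / 4) : stairStep v = 0 := by
  obtain ⟨h1, h2⟩ := abs_le.1 h
  rw [stairStep, max_eq_left (by linarith), max_eq_left (by linarith), sub_zero]

theorem abs_stairStep_sub_le {v : ℝ} (h : |v| ≤ 1 / 2) : |stairStep v - v| ≤ 1 / 4 := by
  obtain ⟨h1, h2⟩ := abs_le.1 h
  rw [stairStep, abs_le]
  constructor <;>
    rcases max_cases 0 (2 * v - 1 / 2) with h3 | h3 <;>
    rcases max_cases 0 (-(2 * v) - 1 / 2) with h4 | h4 <;> linarith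

/-- A staircase curve in the strip `ℝ × [0, 1]`, along the line of height `1`, which fills the
strip by a loop in the middle of each step. -/
theorem exists_staircase_filling_strip :
    ∃ X Y : ℝ → ℝ, Continuous X ∧ Continuous Y ∧
      (∀ (k : ℤ) (u : ℝ), X (u + k) = X u + k ∧ Y (u + k) = Y u) ∧
      (∀ u, Y u ∈ Set.Icc (0 : ℝ) 1) ∧
      (∀ (k : ℤ) (v : ℝ), |v| ≤ 1 / 24 → |X (k + v) - k| ≤ 1 / 2) ∧
      (∀ (k : ℤ) (v : ℝ), 1 / 24 ≤ |v| → |v| ≤ 1 / 2 →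
        X (k + v) = k + stairStep v ∧ Y (k + v) = 1) ∧
      ∀ x y : ℝ, y ∈ Set.Icc (0 : ℝ) 1 → ∃ u, X u = x ∧ Y u = y := by
  obtain ⟨x, y, hx, hy, hxb, hyb, hout, hfill⟩ :=
    exists_loop_filling_rectangle (r := 1 / 24) (by norm_num)
  have hss : Continuous stairStep := by unfold stairStep; fun_prop
  have hs1 : stairStep (1 / 2) = 1 / 2 := by norm_num [stairStep]
  have hx0 : x (1 / 2) = 0 := (hout _ (by norm_num [abs_of_pos])).1
  have hx1 : x (-(1 / 2)) = 0 := (hout _ (by rw [abs_neg]; norm_num [abs_of_pos])).1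
  have hy0 : y (1 / 2) = 1 := (hout _ (by norm_num [abs_of_pos])).2
  have hy1 : y (-(1 / 2)) = 1 := (hout _ (by rw [abs_neg]; norm_num [abs_of_pos])).2
  -- The deviation of the staircase from the diagonal; it is periodic although the staircase is not.
  set g : ℝ → ℝ := fun v => x v + stairStep v - v with hg
  have hgp : g (-(1 / 2)) = g (1 / 2) := by
    simp only [hg, hx0, hx1, stairStep_neg, hs1]; norm_num
  have hyp : y (-(1 / 2)) = y (1 / 2) := by rw [hy0, hy1]
  have hX : ∀ (k : ℤ) (v : ℝ), |v| ≤ 1 / 2 → k + v + periodize 1 g (k + v) = k + x v + stairStep v := by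
    intro k v hv
    rw [periodize_eq one_pos hgp k hv (by ring)]; simp only [hg]; ring
  have hY : ∀ (k : ℤ) (v : ℝ), |v| ≤ 1 / 2 → periodize 1 y (k + v) = y v := fun k v hv =>
    periodize_eq one_pos hyp k hv (by ring)
  refine ⟨fun u => u + periodize 1 g u, periodize 1 y,
    continuous_id.add (continuous_periodize (by fun_prop) hgp), continuous_periodize hy hyp,
    fun k u => ⟨?_, ?_⟩, fun u => hyb _, fun k v hv => ?_, fun k v hv hv' => ⟨?_, ?_⟩,
    fun a b hb => ?_⟩
  · have := periodize_add one_pos g u k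
    rw [one_mul] at this
    simp only [this]; ring
  · have := periodize_add one_pos y u k
    rwa [one_mul] at this
  · simp only [hX k v (by linarith), stairStep_eq_zero (v := v) (by linarith)]
    have := hxb v
    rwa [show (k : ℝ) + x v + 0 - k = x v by ring]
  · simp only [hX k v hv', (hout v hv).1, add_zero]
  · rw [hY k v hv', (hout v hv).2]
  · obtain ⟨k, v, hv, rfl⟩ := exists_int_mul_add one_pos a
    obtain ⟨w, hw, hw1, hw2⟩ := hfill v b hv hb
    refine ⟨k + w, ?_, ?_⟩
    · simp only [hX k w (by linarith), stairStep_eq_zero (v := w) (by linarith), hw1]; ring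
    · rw [hY k w (by linarith), hw2]

/-! ### The delay near even integers and the distance to the diagonal. -/

/-- A tent with support `[0, 2l - d/4]` and maximum `l - d/4` at `l`. -/
noncomputable def lagTent (l d t : ℝ) : ℝ := max 0 (min ((1 - d / (4 * l)) * t) (2 * l - d / 4 - t))

/-- The odd function made of two tents. -/
noncomputable def lagStep (l d t : ℝ) : ℝ := lagTent l d t - lagTent l d (-t)

/-- A continuous time change that slows down near the even integers: it maps `[-l, l]` linearly
onto `[-d/4, d/4]`, and is the identity at distance at least `2l` from the even integers. -/
noncomputable def lag (l d t : ℝ) : ℝ := t - periodize 2 (lagStep l d) t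

section lag

variable {l d : ℝ}

theorem lagStep_neg (t : ℝ) : lagStep l d (-t) = -lagStep l d t := by
  unfold lagStep; rw [neg_neg]; ring

theorem lagStep_of_nonneg (hl : 0 < l) (hdl : d ≤ l) {t : ℝ} (ht : 0 ≤ t) :
    lagStep l d t = lagTent l d t := by
  have h1 : d / (4 * l) ≤ 1 := by rw [div_le_one (by positivity)]; linarith
  have : lagTent l d (-t) = 0 :=
    max_eq_left (min_le_of_left_le (mul_nonpos_of_nonneg_of_nonpos (by linarith) (by linarith)))
  rw [lagStep, this, sub_zero]

theorem lagStep_one (hl : 0 < l) (hl2 : l < 1 / 2) (hd : 0 < d) (hdl : d ≤ l) :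
    lagStep l d 1 = 0 := by
  rw [lagStep_of_nonneg hl hdl zero_le_one]
  exact max_eq_left (min_le_of_right_le (by linarith))

theorem lagStep_periodic (hl : 0 < l) (hl2 : l < 1 / 2) (hd : 0 < d) (hdl : d ≤ l) :
    lagStep l d (-(2 / 2)) = lagStep l d (2 / 2) := by
  norm_num [lagStep_neg, lagStep_one hl hl2 hd hdl]

theorem continuous_lag (hl : 0 < l) (hl2 : l < 1 / 2) (hd : 0 < d) (hdl : d ≤ l) :
    Continuous (lag l d) := by
  refine continuous_id.sub (continuous_periodize ?_ (lagStep_periodic hl hl2 hd hdl))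
  unfold lagStep lagTent; fun_prop

theorem lag_add (t : ℝ) (k : ℤ) : lag l d (t + 2 * k) = lag l d t + 2 * k := by
  rw [lag, periodize_add two_pos, lag]; ring

theorem lag_eq (hl : 0 < l) (hl2 : l < 1 / 2) (hd : 0 < d) (hdl : d ≤ l) {t : ℝ} (ht : |t| ≤ 1) :
    lag l d t = t - lagStep l d t := by
  rw [lag, periodize_eq two_pos (lagStep_periodic hl hl2 hd hdl) 0 (v := t) (by linarith) (by simp)]

theorem lag_neg (hl : 0 < l) (hl2 : l < 1 / 2) (hd : 0 < d) (hdl : d ≤ l) {t : ℝ} (ht : |t| ≤ 1) :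
    lag l d (-t) = -lag l d t := by
  rw [lag_eq hl hl2 hd hdl ht, lag_eq hl hl2 hd hdl (by rwa [abs_neg]), lagStep_neg]; ring

theorem lag_of_le (hl : 0 < l) (hl2 : l < 1 / 2) (hd : 0 < d) (hdl : d ≤ l) {t : ℝ} (h0 : 0 ≤ t)
    (h1 : t ≤ l) : lag l d t = d * (t / (4 * l)) := by
  rw [lag_eq hl hl2 hd hdl (abs_le.2 ⟨by linarith, by linarith⟩), lagStep_of_nonneg hl hdl h0,
    lagTent]
  have h2 : d / (4 * l) ≤ 1 := by rw [div_le_one (by positivity)]; linarith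
  have h3 : (1 - d / (4 * l)) * t ≤ 2 * l - d / 4 - t := by
    have : (1 - d / (4 * l)) * t ≤ (1 - d / (4 * l)) * l :=
      mul_le_mul_of_nonneg_left h1 (by linarith)
    have : (1 - d / (4 * l)) * l = l - d / 4 := by field_simp
    linarith
  rw [min_eq_left h3, max_eq_right (mul_nonneg (by linarith) h0)]
  ring

theorem lag_of_ge (hl : 0 < l) (hl2 : l < 1 / 2) (hd : 0 < d) (hdl : d ≤ l) {t : ℝ} (h0 : l ≤ t)
    (h1 : t ≤ 1) : lag l d t = t - max 0 (2 * l - d / 4 - t) := by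
  rw [lag_eq hl hl2 hd hdl (abs_le.2 ⟨by linarith, by linarith⟩),
    lagStep_of_nonneg hl hdl (by linarith), lagTent]
  have h2 : d / (4 * l) ≤ 1 := by rw [div_le_one (by positivity)]; linarith
  have h3 : 2 * l - d / 4 - t ≤ (1 - d / (4 * l)) * t := by
    have : (1 - d / (4 * l)) * l ≤ (1 - d / (4 * l)) * t :=
      mul_le_mul_of_nonneg_left h0 (by linarith)
    have : (1 - d / (4 * l)) * l = l - d / 4 := by field_simp
    linarith
  rw [min_eq_right h3]

theorem lag_mem (hl : 0 < l) (hl2 : l < 1 / 2) (hd : 0 < d) (hdl : d ≤ l) {t : ℝ} (h0 : 0 ≤ t)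
    (h1 : t ≤ 1) : 0 ≤ lag l d t ∧ lag l d t ≤ t := by
  rcases le_total t l with h | h
  · rw [lag_of_le hl hl2 hd hdl h0 h]
    refine ⟨by positivity, ?_⟩
    rw [← mul_div_assoc, div_le_iff₀ (by positivity)]
    nlinarith
  · rw [lag_of_ge hl hl2 hd hdl h h1]
    rcases max_cases 0 (2 * l - d / 4 - t) with h3 | h3 <;> constructor <;> linarith

/-- A point `w` of a staircase over `u`: close to `u`, or on the loop of some step. -/
def StairClose (u w : ℝ) : Prop :=
  (|w - u| ≤ 1 / 4 ∧ (|u| ≤ 1 / 4 → w = 0)) ∨ ∃ k : ℤ, |u - k| ≤ 1 / 24 ∧ |w - k| ≤ 1 / 2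

theorem StairClose.neg {u w : ℝ} (h : StairClose u w) : StairClose (-u) (-w) := by
  rcases h with ⟨h1, h2⟩ | ⟨k, h1, h2⟩
  · refine Or.inl ⟨by rwa [← neg_sub', abs_neg], fun h => ?_⟩
    rw [abs_neg] at h; rw [h2 h, neg_zero]
  · refine Or.inr ⟨-k, ?_, ?_⟩
    · rw [Int.cast_neg, ← neg_sub', abs_neg]; exact h1
    · rw [Int.cast_neg, ← neg_sub', abs_neg]; exact h2

/-- The total error `l` is shared between delay and staircase. For `t ≤ l` the staircase still rests
at `0`, except during its loop, when `t ≤ l / 6` and the excursion is at most `d / 2`. For `t ≥ l`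
the delay is at most `l - d / 4`, leaving `d / 4` for the staircase. The loops of later steps
deviate by up to `13 d / 24`, but by then the delay has decreased enough. -/
theorem StairClose.abs_sub_le_of_nonneg (hl : 0 < l) (hl2 : l < 1 / 2) (hd : 0 < d) (hdl : d ≤ l)
    {t u w : ℝ} (h0 : 0 ≤ t) (h1 : t ≤ 1) (hu : lag l d t = d * u) (h : StairClose u w) :
    |d * w - t| ≤ l := by
  rcases le_total t l with htl | htl
  · rw [lag_of_le hl hl2 hd hdl h0 htl] at hu
    have hu := (mul_left_cancel₀ hd.ne' hu).symm
    have hu0 : 0 ≤ u := by rw [hu]; positivity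
    have htu : t = 4 * l * u := by rw [hu]; field_simp
    have hu4 : u ≤ 1 / 4 := by rw [hu, div_le_iff₀ (by positivity)]; linarith
    rcases h with ⟨-, h2⟩ | ⟨k, hk1, hk2⟩
    · rw [h2 (abs_le.2 ⟨by linarith, hu4⟩), mul_zero, zero_sub, abs_neg, abs_of_nonneg h0]
      exact htl
    · rw [abs_le] at hk1 hk2
      have hk : k = 0 := by
        have h1 : (k : ℝ) < 1 := by linarith
        have h2 : (-1 : ℝ) < k := by linarith
        have h1 : k < 1 := by exact_mod_cast h1
        have h2 : -1 < k := by exact_mod_cast h2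
        omega
      rw [hk] at hk1 hk2
      simp only [Int.cast_zero, sub_zero] at hk1 hk2
      have : t ≤ l / 6 := by rw [htu]; nlinarith
      rw [abs_le]; constructor <;> nlinarith
  · rw [lag_of_ge hl hl2 hd hdl htl h1] at hu
    have hmax := le_max_right 0 (2 * l - d / 4 - t)
    have hmax0 := le_max_left 0 (2 * l - d / 4 - t)
    have hmaxle : max 0 (2 * l - d / 4 - t) ≤ l - d / 4 := max_le (by linarith) (by linarith)
    have hu4 : 1 / 4 ≤ u := by
      by_contra hcon
      have : d * u < d * (1 / 4) := by gcongr; linarith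
      linarith
    rcases h with ⟨h2, -⟩ | ⟨k, hk1, hk2⟩
    · rw [abs_le] at h2 ⊢
      have := mul_le_mul_of_nonneg_left h2.1 hd.le
      have := mul_le_mul_of_nonneg_left h2.2 hd.le
      constructor <;> linarith
    · rw [abs_le] at hk1 hk2
      have hk : (1 : ℝ) ≤ k := by
        have : (0 : ℝ) < k := by linarith
        have : 0 < k := by exact_mod_cast this
        exact_mod_cast this
      have e1 : d * (23 / 24) ≤ d * u := mul_le_mul_of_nonneg_left (by linarith) hd.le
      have e2 : d * (w - u) ≤ d * (13 / 24) := mul_le_mul_of_nonneg_left (by linarith) hd.le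
      have e3 : d * (-(13 / 24)) ≤ d * (w - u) := mul_le_mul_of_nonneg_left (by linarith) hd.le
      rw [abs_le]
      rcases max_cases 0 (2 * l - d / 4 - t) with h3 | h3 <;> constructor <;> linarith

theorem StairClose.abs_sub_le (hl : 0 < l) (hl2 : l < 1 / 2) (hd : 0 < d) (hdl : d ≤ l)
    {t u w : ℝ} (ht : |t| ≤ 1) (hu : lag l d t = d * u) (h : StairClose u w) :
    |d * w - t| ≤ l := by
  obtain ⟨h1, h2⟩ := abs_le.1 ht
  rcases le_total 0 t with h0 | h0
  · exact h.abs_sub_le_of_nonneg hl hl2 hd hdl h0 h2 hu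
  · have := h.neg.abs_sub_le_of_nonneg hl hl2 hd hdl (t := -t) (by linarith) (by linarith)
      (by rw [lag_neg hl hl2 hd hdl ht, hu]; ring)
    rwa [show d * -w - -t = -(d * w - t) by ring, abs_neg] at this

end lag

/-! ### Mirror-symmetric times and the strip-filling curve. -/

/-- Without its loops the staircase is monotone and fixes the integers, so it cannot overshoot `M`.
This keeps the symmetric positions within half a sector, where `tri_mirror` applies. -/
theorem add_stairStep_le {k M : ℤ} {v : ℝ} (hv : |v| ≤ 1 / 2) (h : k + v ≤ (M : ℝ)) :
    k + stairStep v ≤ (M : ℝ) := by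
  obtain ⟨h1, h2⟩ := abs_le.1 hv
  rcases le_total 0 v with h0 | h0
  · rcases h0.eq_or_lt with rfl | h0
    · rw [stairStep_eq_zero (by norm_num)]; exact h
    · have : (k : ℝ) < M := by linarith
      have : k + 1 ≤ M := by exact_mod_cast this
      have : (k : ℝ) + 1 ≤ M := by exact_mod_cast this
      have := (abs_le.1 (abs_stairStep_sub_le hv)).2
      linarith
  · have hs : stairStep v ≤ 0 := by
      rw [stairStep, max_eq_left (by linarith)]
      linarith [le_max_left 0 (-(2 * v) - 1 / 2)]
    have : (k : ℝ) < M + 1 := by linarith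
    have : k < M + 1 := by exact_mod_cast this
    have : k ≤ M := by omega
    have : (k : ℝ) ≤ M := by exact_mod_cast this
    linarith

/-- A delayed staircase takes mirror-symmetric positions at times with any given sum. -/
theorem exists_symmetric_times {l d : ℝ} {X Y : ℝ → ℝ} {M : ℕ} (hl : 0 < l) (hl2 : l < 1 / 2)
    (hd0 : 0 < d) (hdl : d ≤ l) (hdM : d * M = 1 / 2)
    (hstair : ∀ (k : ℤ) (v : ℝ), 1 / 24 ≤ |v| → |v| ≤ 1 / 2 →
      X (k + v) = k + stairStep v ∧ Y (k + v) = 1)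
    (hrest : ∀ t, l / 3 ≤ |t| → |t| ≤ l → d * X (lag l d t / d) = 0 ∧ Y (lag l d t / d) = 1)
    {α : ℝ} (hα : α ∈ Set.Icc (0 : ℝ) (1 / 2)) :
    ∃ a b g : ℝ, a + b = 2 * α ∧ g ∈ Set.Icc (0 : ℝ) (1 / 2) ∧ d * X (lag l d a / d) = g ∧
      d * X (lag l d (-b) / d) = -g ∧ Y (lag l d a / d) = 1 ∧ Y (lag l d (-b) / d) = 1 := by
  obtain ⟨hα0, hα1⟩ := hα
  obtain ⟨hp0, hp1⟩ := lag_mem hl hl2 hd0 hdl hα0 (by linarith)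
  obtain ⟨k, v, hv, hu⟩ := exists_int_mul_add one_pos (lag l d α / d)
  rw [one_mul] at hu
  have hneg : ∀ t, |t| ≤ 1 → lag l d (-t) / d = -(lag l d t / d) := fun t ht => by
    rw [lag_neg hl hl2 hd0 hdl ht, neg_div]
  have hu0 : (0 : ℝ) ≤ k + v := by rw [← hu]; positivity
  have huM : k + v ≤ ((M : ℤ) : ℝ) := by
    rw [← hu, div_le_iff₀ hd0, Int.cast_natCast]; linarith
  have hval : ∀ w : ℝ, 0 ≤ w → w ≤ M → d * w ∈ Set.Icc (0 : ℝ) (1 / 2) := fun w h0 h1 =>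
    ⟨by positivity, by rw [← hdM]; gcongr⟩
  -- Off the loops the delayed staircase is odd, so the times `α` and `-α` work. On a loop, both
  -- times are moved onto the resting part of the same step, keeping their sum.
  rcases le_total (1 / 24) |v| with h | h
  · refine ⟨α, α, d * (k + stairStep v), by ring, hval _ ?_ ?_, ?_, ?_, ?_, ?_⟩
    · have := add_stairStep_le (k := -k) (M := 0) (v := -v) (by rwa [abs_neg])
        (by push_cast; linarith)
      rw [stairStep_neg] at this
      push_cast at this; linarith
    · exact_mod_cast add_stairStep_le hv huM
    · rw [hu, (hstair k v h hv).1]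
    · have := (hstair (-k) (-v) (by rwa [abs_neg]) (by rwa [abs_neg])).1
      rw [stairStep_neg] at this
      push_cast at this
      rw [hneg α (abs_le.2 ⟨by linarith, by linarith⟩), hu, neg_add, this]; ring
    · rw [hu, (hstair k v h hv).2]
    · have := (hstair (-k) (-v) (by rwa [abs_neg]) (by rwa [abs_neg])).2
      push_cast at this
      rw [hneg α (abs_le.2 ⟨by linarith, by linarith⟩), hu, neg_add, this]
  · rw [abs_le] at h
    rcases le_or_gt k 0 with hk | hk
    · have hk : k = 0 := by
        have : (-1 : ℝ) < k := by linarith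
        have : -1 < k := by exact_mod_cast this
        omega
      subst hk
      have hαl : α ≤ l / 6 := by
        rcases le_total α l with hle | hle
        · rw [lag_of_le hl hl2 hd0 hdl hα0 hle, mul_div_cancel_left₀ _ hd0.ne',
            div_eq_iff (by positivity)] at hu
          push_cast at hu
          nlinarith
        · exfalso
          rw [lag_of_ge hl hl2 hd0 hdl hle (by linarith), div_eq_iff hd0.ne'] at hu
          push_cast at hu
          have : max 0 (2 * l - d / 4 - α) ≤ α - d / 4 := max_le (by linarith) (by linarith)
          nlinarith
      -- Since `α ≤ l / 6`, the shift by `l / 2` brings both times into the rest at the center: `α +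
      -- l / 2` and `l / 2 - α` lie between `l / 3` and `2 * l / 3`.
      have ha : |α + l / 2| = α + l / 2 := abs_of_nonneg (by positivity)
      have hb : |-(α - l / 2)| = -(α - l / 2) := abs_of_nonneg (by linarith)
      have h1 := hrest (α + l / 2) (by rw [ha]; linarith) (by rw [ha]; linarith)
      have h2 := hrest (-(α - l / 2)) (by rw [hb]; linarith) (by rw [hb]; linarith)
      exact ⟨α + l / 2, α - l / 2, 0, by ring, by norm_num, h1.1, by rw [neg_zero]; exact h2.1,
        h1.2, h2.2⟩
    · have hk1 : (1 : ℝ) ≤ k := by exact_mod_cast hk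
      have hkM : (k : ℝ) ≤ M := by
        have : (k : ℝ) < M + 1 := by push_cast at huM; linarith
        have : k < M + 1 := by exact_mod_cast this
        have : k ≤ M := by omega
        exact_mod_cast this
      rw [div_eq_iff hd0.ne'] at hu
      have hbig : d * (23 / 24) ≤ lag l d α := by
        rw [hu, mul_comm]; gcongr; linarith
      have hαl : l + d * (17 / 48) ≤ α := by
        rcases le_total α l with hle | hle
        · exfalso
          rw [lag_of_le hl hl2 hd0 hdl hα0 hle] at hbig
          have : α / (4 * l) ≤ 1 / 4 := by rw [div_le_iff₀ (by positivity)]; linarith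
          nlinarith
        · rw [lag_of_ge hl hl2 hd0 hdl hle (by linarith)] at hbig
          linarith [le_max_right 0 (2 * l - d / 4 - α)]
      have hstep : ∀ w : ℝ, 1 / 24 ≤ |w| → |w| ≤ 1 / 4 →
          X (k + w) = k ∧ Y (k + w) = 1 ∧ X (-(k + w)) = -k ∧ Y (-(k + w)) = 1 := by
        intro w h1 h2
        have e1 := hstair k w h1 (by linarith)
        have e2 := hstair (-k) (-w) (by rwa [abs_neg]) (by rw [abs_neg]; linarith)
        rw [stairStep_eq_zero h2, add_zero] at e1
        rw [stairStep_neg, stairStep_eq_zero h2] at e2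
        push_cast at e2
        rw [← neg_add, neg_zero, add_zero] at e2
        exact ⟨e1.1, e1.2, e2.1, e2.2⟩
      rw [lag_of_ge hl hl2 hd0 hdl (by linarith) (by linarith)] at hu
      -- Beyond `l` the delayed time has slope `1` or `2`, so a shift by `d / 12` moves the
      -- staircase parameter by `1 / 12` to `1 / 6`. As `|v| ≤ 1 / 24`, it lands between `1 / 24`
      -- and `5 / 24` from `k`, where the staircase rests.
      have hplus := lag_of_ge hl hl2 hd0 hdl (t := α + d / 12) (by linarith) (by linarith)
      have hminus := lag_of_ge hl hl2 hd0 hdl (t := α - d / 12) (by linarith) (by linarith)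
      obtain ⟨w, hw⟩ : ∃ w, lag l d (α + d / 12) / d = k + w := ⟨_, (add_sub_cancel _ _).symm⟩
      obtain ⟨z, hz⟩ : ∃ z, lag l d (α - d / 12) / d = k + z := ⟨_, (add_sub_cancel _ _).symm⟩
      have hw' := hw
      have hz' := hz
      rw [div_eq_iff hd0.ne', hplus] at hw'
      rw [div_eq_iff hd0.ne', hminus] at hz'
      have hwv : d * (1 / 12) ≤ d * (w - v) ∧ d * (w - v) ≤ d * (1 / 6) := by
        rcases max_cases 0 (2 * l - d / 4 - α) with h3 | h3 <;>
        rcases max_cases 0 (2 * l - d / 4 - (α + d / 12)) with h4 | h4 <;>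
        constructor <;> linarith
      have hzv : d * (1 / 12) ≤ d * (v - z) ∧ d * (v - z) ≤ d * (1 / 6) := by
        rcases max_cases 0 (2 * l - d / 4 - α) with h3 | h3 <;>
        rcases max_cases 0 (2 * l - d / 4 - (α - d / 12)) with h4 | h4 <;>
        constructor <;> linarith
      have a1 := le_of_mul_le_mul_left hwv.1 hd0
      have a2 := le_of_mul_le_mul_left hwv.2 hd0
      have a3 := le_of_mul_le_mul_left hzv.1 hd0
      have a4 := le_of_mul_le_mul_left hzv.2 hd0
      obtain ⟨w1, w2, -, -⟩ := hstep w (by rw [abs_of_nonneg] <;> linarith)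
        (by rw [abs_of_nonneg] <;> linarith)
      obtain ⟨-, -, z1, z2⟩ := hstep z (by rw [abs_of_nonpos] <;> linarith)
        (by rw [abs_of_nonpos] <;> linarith)
      have hbn := hneg (α - d / 12) (abs_le.2 ⟨by linarith, by linarith⟩)
      refine ⟨α + d / 12, α - d / 12, d * k, by ring, hval _ (by linarith) hkM, ?_, ?_, ?_, ?_⟩
      · rw [hw, w1]
      · rw [hbn, hz, z1]; ring
      · rw [hw, w2]
      · rw [hbn, hz, z2]

/-- A curve in the strip `ℝ × [0, 1]` that fills the strip, stays at horizontal distance at most `l`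
from the diagonal motion, rests at `(0, 1)` for times `t` with `l / 3 ≤ |t| ≤ l`, and
takes mirror-symmetric positions on the line of height `1` at times with any given sum. -/
theorem exists_strip_filling_curve {l : ℝ} (hl : 0 < l) (hl2 : l < 1 / 2) :
    ∃ G Y : ℝ → ℝ, Continuous G ∧ Continuous Y ∧
      (∀ (k : ℤ) (t : ℝ), G (t + 2 * k) = G t + 2 * k ∧ Y (t + 2 * k) = Y t) ∧
      (∀ t, Y t ∈ Set.Icc (0 : ℝ) 1) ∧ (∀ t, |G t - t| ≤ l) ∧
      (∀ x y : ℝ, y ∈ Set.Icc (0 : ℝ) 1 → ∃ t, G t = x ∧ Y t = y) ∧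
      (∀ t, l / 3 ≤ |t| → |t| ≤ l → G t = 0 ∧ Y t = 1) ∧
      ∀ α ∈ Set.Icc (0 : ℝ) (1 / 2), ∃ a b g : ℝ, a + b = 2 * α ∧ g ∈ Set.Icc (0 : ℝ) (1 / 2) ∧
        G a = g ∧ G (-b) = -g ∧ Y a = 1 ∧ Y (-b) = 1 := by
  obtain ⟨X, Y, hXc, hYc, hper, hY, hloop, hstair, hfill⟩ := exists_staircase_filling_strip
  obtain ⟨M, hM⟩ := exists_nat_gt (1 / (2 * l))
  have hM0 : (0 : ℝ) < M := lt_trans (by positivity) hM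
  -- The step length divides `1 / 2`: then the period `2` is a whole number `4 * M` of steps, and a
  -- step is centered at the sector border `1 / 2`.
  set d : ℝ := 1 / (2 * M) with hd
  have hd0 : 0 < d := by positivity
  have hdM : d * M = 1 / 2 := by rw [hd]; field_simp
  have hdl : d ≤ l := by
    rw [hd, div_le_iff₀ (by positivity)]
    rw [div_lt_iff₀ (by positivity)] at hM
    linarith
  have hclose : ∀ u, StairClose u (X u) := by
    intro u
    obtain ⟨k, v, hv, hu⟩ := exists_int_mul_add one_pos u
    rw [one_mul] at hu
    rcases le_total (1 / 24) |v| with h | h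
    · left
      rw [hu, (hstair k v h hv).1, show (k : ℝ) + stairStep v - (k + v) = stairStep v - v by ring]
      refine ⟨abs_stairStep_sub_le hv, fun h' => ?_⟩
      rw [abs_le] at h' hv
      have hk : k = 0 := by
        have h1 : (k : ℝ) < 1 := by linarith
        have h2 : (-1 : ℝ) < k := by linarith
        have h1 : k < 1 := by exact_mod_cast h1
        have h2 : -1 < k := by exact_mod_cast h2
        omega
      subst hk
      rw [stairStep_eq_zero (abs_le.2 (by simpa using h'))]; simp
    · right
      refine ⟨k, ?_, ?_⟩
      · rwa [hu, add_sub_cancel_left]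
      · rw [hu]; exact hloop k v h
  have hlagc := continuous_lag hl hl2 hd0 hdl
  have hGper : ∀ (k : ℤ) (t : ℝ), d * X (lag l d (t + 2 * k) / d) = d * X (lag l d t / d) + 2 * k ∧
      Y (lag l d (t + 2 * k) / d) = Y (lag l d t / d) := by
    intro k t
    have e : lag l d (t + 2 * k) / d = lag l d t / d + ((4 * M * k : ℤ) : ℝ) := by
      rw [lag_add, hd]; push_cast; field_simp; ring
    rw [e, (hper _ _).1, (hper _ _).2]
    refine ⟨?_, rfl⟩
    push_cast
    linear_combination (4 * (k : ℝ)) * hdM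
  have hGclose : ∀ t, |d * X (lag l d t / d) - t| ≤ l := by
    intro t
    obtain ⟨k, v, hv, rfl⟩ := exists_int_mul_add two_pos t
    rw [add_comm, (hGper k v).1, add_sub_add_right_eq_sub]
    exact (hclose _).abs_sub_le hl hl2 hd0 hdl (by linarith) (by field_simp)
  have hrest : ∀ t, l / 3 ≤ |t| → |t| ≤ l →
      d * X (lag l d t / d) = 0 ∧ Y (lag l d t / d) = 1 := by
    have key : ∀ v : ℝ, 1 / 24 ≤ |v| → |v| ≤ 1 / 4 → d * X v = 0 ∧ Y v = 1 := by
      intro v h1 h2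
      have := hstair 0 v h1 (by linarith)
      rw [Int.cast_zero, zero_add, stairStep_eq_zero h2, zero_add] at this
      rw [this.1, this.2]; simp
    intro t h1 h2
    have e : |lag l d t / d| = |t| / (4 * l) := by
      rcases le_total 0 t with h0 | h0
      · rw [abs_of_nonneg h0] at h2 ⊢
        rw [lag_of_le hl hl2 hd0 hdl h0 h2, mul_div_cancel_left₀ _ hd0.ne',
          abs_of_nonneg (by positivity)]
      · rw [abs_of_nonpos h0] at h2 ⊢
        have := lag_of_le hl hl2 hd0 hdl (t := -t) (by linarith) h2
        rw [lag_neg hl hl2 hd0 hdl (abs_le.2 ⟨by linarith, by linarith⟩)] at this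
        rw [← abs_neg, ← neg_div, this, mul_div_cancel_left₀ _ hd0.ne', abs_of_nonneg]
        exact div_nonneg (by linarith) (by positivity)
    refine key _ ?_ ?_
    · rw [e, le_div_iff₀ (by positivity)]; linarith
    · rw [e, div_le_iff₀ (by positivity)]; linarith
  refine ⟨fun t => d * X (lag l d t / d), fun t => Y (lag l d t / d), by fun_prop, by fun_prop,
    hGper, fun t => hY _, hGclose, ?_, hrest, ?_⟩
  · intro x y hy
    obtain ⟨u, hu1, hu2⟩ := hfill (x / d) y hy
    have hlag : ∀ (k : ℤ), lag l d (2 * k) = 2 * k := fun k => by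
      have := lag_add (l := l) (d := d) 0 k
      rw [lag_of_le hl hl2 hd0 hdl le_rfl hl.le] at this
      simpa using this
    obtain ⟨k, v, hv, hkv⟩ := exists_int_mul_add two_pos (d * u)
    -- The delayed time fixes the even integers, so by the intermediate value theorem it takes every
    -- value.
    have hmem : d * u ∈ Set.Icc (lag l d (2 * (k - 1 : ℤ))) (lag l d (2 * (k + 1 : ℤ))) := by
      rw [hlag, hlag, hkv]; push_cast
      rw [abs_le] at hv
      constructor <;> linarith
    obtain ⟨t, ht⟩ := intermediate_value_univ _ _ hlagc hmem
    refine ⟨t, ?_, ?_⟩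
    · simp only [ht]; rw [mul_div_cancel_left₀ _ hd0.ne', hu1, mul_div_cancel₀ _ hd0.ne']
    · simp only [ht]; rw [mul_div_cancel_left₀ _ hd0.ne', hu2]
  · exact fun α hα => exists_symmetric_times hl hl2 hd0 hdl hdM hstair hrest hα

/-! ### The chart of the triangle by the strip. -/

/-- A coordinate, minus the minimal one, along the boundary of the triangle: `-1` on one side and
linear, with values up to `2`, on the two others. -/
noncomputable def sideCoord (t : ℝ) : ℝ := max (-1) (3 * periodize 3 (fun v => |v|) t - 5 / 2)

/-- A `6`-periodic tent over `[-1/2, 1/2]`. -/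
noncomputable def hexTent (t : ℝ) : ℝ := max 0 (1 - 2 * periodize 6 (fun v => |v|) t)

/-- The first barycentric coordinate of the triangle chart. -/
noncomputable def triFst (t y : ℝ) : ℝ :=
  sideCoord t + y * (hexTent t - (hexTent (t - 2) + hexTent (t - 4)) / 2)

/-- The second barycentric coordinate of the triangle chart. -/
noncomputable def triSnd (t y : ℝ) : ℝ :=
  sideCoord (t - 1) + y * (hexTent (t - 4) - (hexTent t + hexTent (t - 2)) / 2)

theorem continuous_sideCoord : Continuous sideCoord := by
  have : Continuous (periodize 3 fun v => |v|) := continuous_periodize continuous_abs (by norm_num)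
  unfold sideCoord; fun_prop

theorem continuous_hexTent : Continuous hexTent := by
  have : Continuous (periodize 6 fun v => |v|) := continuous_periodize continuous_abs (by norm_num)
  unfold hexTent; fun_prop

theorem sideCoord_add (t : ℝ) (k : ℤ) : sideCoord (t + 6 * k) = sideCoord t := by
  have := periodize_add three_pos (fun v => |v|) t (2 * k)
  rw [show t + 3 * ((2 * k : ℤ) : ℝ) = t + 6 * k by push_cast; ring] at this
  rw [sideCoord, this, sideCoord]

theorem hexTent_add (t : ℝ) (k : ℤ) : hexTent (t + 6 * k) = hexTent t := by
  rw [hexTent, periodize_add (by norm_num), hexTent]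

theorem triFst_add (t y : ℝ) (k : ℤ) : triFst (t + 6 * k) y = triFst t y := by
  simp only [triFst, sideCoord_add, hexTent_add, add_sub_right_comm]

theorem triSnd_add (t y : ℝ) (k : ℤ) : triSnd (t + 6 * k) y = triSnd t y := by
  simp only [triSnd, sideCoord_add, hexTent_add, add_sub_right_comm]

theorem sideCoord_low {t : ℝ} (k : ℤ) (v : ℝ) (ht : t = 3 * k + v) (h : |v| ≤ 1 / 2) :
    sideCoord t = -1 := by
  rw [sideCoord, periodize_eq three_pos (by norm_num) k (by linarith) ht]
  exact max_eq_left (by linarith)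

theorem sideCoord_up {t : ℝ} (k : ℤ) (v : ℝ) (ht : t = 3 * k + v) (h1 : 1 / 2 ≤ v)
    (h2 : v ≤ 3 / 2) : sideCoord t = 3 * v - 5 / 2 := by
  have hv : |v| = v := abs_of_nonneg (by linarith)
  rw [sideCoord, periodize_eq three_pos (by norm_num) k (by linarith) ht, hv]
  exact max_eq_right (by linarith)

theorem sideCoord_down {t : ℝ} (k : ℤ) (v : ℝ) (ht : t = 3 * k - v) (h1 : 1 / 2 ≤ v)
    (h2 : v ≤ 3 / 2) : sideCoord t = 3 * v - 5 / 2 := by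
  have hv : |-v| = v := by rw [abs_neg]; exact abs_of_nonneg (by linarith)
  rw [sideCoord, periodize_eq three_pos (by norm_num) k (v := -v) (by linarith) (by linarith), hv]
  exact max_eq_right (by linarith)

theorem hexTent_mid {t : ℝ} (h : |t| ≤ 1 / 2) : hexTent t = 1 - 2 * |t| := by
  rw [hexTent, periodize_eq (by norm_num) (by norm_num) 0 (v := t) (by linarith) (by simp)]
  exact max_eq_right (by linarith)

theorem hexTent_zero {t : ℝ} (h1 : 1 / 2 ≤ t) (h2 : t ≤ 11 / 2) : hexTent t = 0 := by
  rcases le_total t 3 with h | h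
  · rw [hexTent, periodize_eq (by norm_num) (by norm_num) 0 (v := t)
      (by rw [abs_of_nonneg] <;> linarith) (by simp), abs_of_nonneg (by linarith)]
    exact max_eq_left (by linarith)
  · rw [hexTent, periodize_eq (by norm_num) (by norm_num) 1 (v := t - 6)
      (by rw [abs_of_nonpos] <;> linarith) (by push_cast; ring), abs_of_nonpos (by linarith)]
    exact max_eq_left (by linarith)

theorem hexTent_zero' {t : ℝ} (h1 : -(11 / 2) ≤ t) (h2 : t ≤ -(1 / 2)) : hexTent t = 0 := by
  have := hexTent_add t 1
  rw [← this]
  exact hexTent_zero (by push_cast; linarith) (by push_cast; linarith)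

/-- Around `0`, `2`, `4` one tent is active, and the depth `1 - y * (1 - 2 * |s|)` runs from `1` on
the side to `2 * |s|` on the two rays. Around `1`, `3`, `5` all tents vanish, and the boundary is
retraced whatever the height. -/
theorem tri_zero {s : ℝ} (h : |s| ≤ 1 / 2) (y : ℝ) :
    triFst s y = -(1 - y * (1 - 2 * |s|)) ∧
    triSnd s y = (1 - y * (1 - 2 * |s|)) / 2 - 3 * s := by
  obtain ⟨h1, h2⟩ := abs_le.1 h
  rw [triFst, triSnd, hexTent_mid h, hexTent_zero' (t := s - 2) (by linarith) (by linarith),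
    hexTent_zero' (t := s - 4) (by linarith) (by linarith),
    sideCoord_low 0 s (by push_cast; ring) h,
    sideCoord_down 0 (1 - s) (by push_cast; ring) (by linarith) (by linarith)]
  constructor <;> ring

theorem tri_one {s : ℝ} (h : |s| ≤ 1 / 2) (y : ℝ) :
    triFst (1 + s) y = 1 / 2 + 3 * s ∧ triSnd (1 + s) y = -1 := by
  obtain ⟨h1, h2⟩ := abs_le.1 h
  rw [triFst, triSnd, hexTent_zero (by linarith) (by linarith),
    hexTent_zero' (t := 1 + s - 2) (by linarith) (by linarith),
    hexTent_zero' (t := 1 + s - 4) (by linarith) (by linarith),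
    sideCoord_up 0 (1 + s) (by push_cast; ring) (by linarith) (by linarith),
    sideCoord_low 0 s (by push_cast; ring) h]
  constructor <;> ring

theorem tri_two {s : ℝ} (h : |s| ≤ 1 / 2) (y : ℝ) :
    triFst (2 + s) y = (1 - y * (1 - 2 * |s|)) / 2 - 3 * s ∧
    triSnd (2 + s) y = (1 - y * (1 - 2 * |s|)) / 2 + 3 * s := by
  obtain ⟨h1, h2⟩ := abs_le.1 h
  rw [triFst, triSnd, hexTent_zero (by linarith) (by linarith), add_sub_cancel_left, hexTent_mid h,
    hexTent_zero' (t := 2 + s - 4) (by linarith) (by linarith),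
    sideCoord_down 1 (1 - s) (by push_cast; ring) (by linarith) (by linarith),
    sideCoord_up 0 (1 + s) (by push_cast; ring) (by linarith) (by linarith)]
  constructor <;> ring

theorem tri_three {s : ℝ} (h : |s| ≤ 1 / 2) (y : ℝ) :
    triFst (3 + s) y = -1 ∧ triSnd (3 + s) y = 1 / 2 - 3 * s := by
  obtain ⟨h1, h2⟩ := abs_le.1 h
  rw [triFst, triSnd, hexTent_zero (by linarith) (by linarith),
    hexTent_zero (t := 3 + s - 2) (by linarith) (by linarith),
    hexTent_zero' (t := 3 + s - 4) (by linarith) (by linarith),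
    sideCoord_low 1 s (by push_cast; ring) h,
    sideCoord_down 1 (1 - s) (by push_cast; ring) (by linarith) (by linarith)]
  constructor <;> ring

theorem tri_four {s : ℝ} (h : |s| ≤ 1 / 2) (y : ℝ) :
    triFst (4 + s) y = (1 - y * (1 - 2 * |s|)) / 2 + 3 * s ∧
    triSnd (4 + s) y = -(1 - y * (1 - 2 * |s|)) := by
  obtain ⟨h1, h2⟩ := abs_le.1 h
  rw [triFst, triSnd, hexTent_zero (by linarith) (by linarith), add_sub_cancel_left, hexTent_mid h,
    hexTent_zero (t := 4 + s - 2) (by linarith) (by linarith),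
    sideCoord_up 1 (1 + s) (by push_cast; ring) (by linarith) (by linarith),
    sideCoord_low 1 s (by push_cast; ring) h]
  constructor <;> ring

theorem tri_five {s : ℝ} (h : |s| ≤ 1 / 2) (y : ℝ) :
    triFst (5 + s) y = 1 / 2 - 3 * s ∧ triSnd (5 + s) y = 1 / 2 + 3 * s := by
  obtain ⟨h1, h2⟩ := abs_le.1 h
  rw [triFst, triSnd, hexTent_zero (by linarith) (by linarith),
    hexTent_zero (t := 5 + s - 2) (by linarith) (by linarith),
    hexTent_zero (t := 5 + s - 4) (by linarith) (by linarith),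
    sideCoord_down 2 (1 - s) (by push_cast; ring) (by linarith) (by linarith),
    sideCoord_up 1 (1 + s) (by push_cast; ring) (by linarith) (by linarith)]
  constructor <;> ring

/-- The point with coordinates `a`, `b` lies in one of the three sectors of the triangle, at
depth `m` and lateral position `s`, and `t` is a time at which this place is visited. -/
def TriAddress (t a b : ℝ) (k : ℤ) (s m : ℝ) : Prop :=
  -m ≤ 2 * s ∧ 2 * s ≤ m ∧ m ≤ 1 ∧
    (((t = 6 * k + s ∨ m = 1 ∧ t = 6 * k + 3 + s) ∧ a = -m ∧ b = m / 2 - 3 * s) ∨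
      ((t = 6 * k + 4 + s ∨ m = 1 ∧ t = 6 * k + 1 + s) ∧ a = m / 2 + 3 * s ∧ b = -m) ∨
      ((t = 6 * k + 2 + s ∨ m = 1 ∧ t = 6 * k + 5 + s) ∧ a = m / 2 - 3 * s ∧ b = m / 2 + 3 * s))

theorem exists_six_mul_add (t : ℝ) : ∃ (k : ℤ) (s : ℝ), |s| ≤ 1 / 2 ∧
    (t = 6 * k + s ∨ t = 6 * k + (1 + s) ∨ t = 6 * k + (2 + s) ∨ t = 6 * k + (3 + s) ∨
      t = 6 * k + (4 + s) ∨ t = 6 * k + (5 + s)) := by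
  obtain ⟨n, s, hs, rfl⟩ := exists_int_mul_add one_pos t
  refine ⟨n / 6, s, hs, ?_⟩
  have h := Int.mul_ediv_add_emod n 6
  have h0 := Int.emod_nonneg n (by norm_num : (6 : ℤ) ≠ 0)
  have h1 := Int.emod_lt_of_pos n (by norm_num : (0 : ℤ) < 6)
  have hr : (6 : ℝ) * ((n / 6 : ℤ) : ℝ) + ((n % 6 : ℤ) : ℝ) = n := by exact_mod_cast h
  generalize n % 6 = j at *
  interval_cases j <;> push_cast at hr
  · left; linarith
  · right; left; linarith
  · right; right; left; linarith
  · right; right; right; left; linarith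
  · right; right; right; right; left; linarith
  · right; right; right; right; right; linarith

theorem exists_triAddress (t : ℝ) {y : ℝ} (hy : y ∈ Set.Icc (0 : ℝ) 1) :
    ∃ k s m, TriAddress t (triFst t y) (triSnd t y) k s m := by
  obtain ⟨k, s, hs, ht⟩ := exists_six_mul_add t
  obtain ⟨h1, h2⟩ := abs_le.1 hs
  obtain ⟨y0, y1⟩ := hy
  have hm1 : 1 - y * (1 - 2 * |s|) ≤ 1 := by nlinarith
  have hm2 : 2 * |s| ≤ 1 - y * (1 - 2 * |s|) := by nlinarith
  have hs1 := le_abs_self s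
  have hs2 := neg_abs_le s
  have key : ∀ v, triFst (6 * k + v) y = triFst v y ∧ triSnd (6 * k + v) y = triSnd v y :=
    fun v => by rw [add_comm, triFst_add, triSnd_add]; exact ⟨rfl, rfl⟩
  rcases ht with rfl | rfl | rfl | rfl | rfl | rfl <;> rw [(key _).1, (key _).2]
  · refine ⟨k, s, 1 - y * (1 - 2 * |s|), by linarith, by linarith, hm1, Or.inl ⟨Or.inl rfl, ?_⟩⟩
    exact tri_zero hs y
  · refine ⟨k, s, 1, by linarith, by linarith, le_rfl, Or.inr (Or.inl ⟨Or.inr ⟨rfl, by ring⟩, ?_⟩)⟩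
    exact tri_one hs y
  · refine ⟨k, s, 1 - y * (1 - 2 * |s|), by linarith, by linarith, hm1,
      Or.inr (Or.inr ⟨Or.inl (by ring), ?_⟩)⟩
    exact tri_two hs y
  · refine ⟨k, s, 1, by linarith, by linarith, le_rfl, Or.inl ⟨Or.inr ⟨rfl, by ring⟩, ?_⟩⟩
    exact tri_three hs y
  · refine ⟨k, s, 1 - y * (1 - 2 * |s|), by linarith, by linarith, hm1,
      Or.inr (Or.inl ⟨Or.inl (by ring), ?_⟩)⟩
    exact tri_four hs y
  · refine ⟨k, s, 1, by linarith, by linarith, le_rfl, Or.inr (Or.inr ⟨Or.inr ⟨rfl, by ring⟩, ?_⟩)⟩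
    exact tri_five hs y

/-- The depth `m` is minus the least of `a`, `b`, `-a - b`, so it depends only on the point. Within
one sector `s` is determined too, and the times differ by multiples of `3`. Two different sectors
meet only where `2 * |s| = m`, and a finite check of the times remains. -/
theorem TriAddress.eq_or_two_le {t t' a b : ℝ} {k k' : ℤ} {s s' m m' : ℝ}
    (h : TriAddress t a b k s m) (h' : TriAddress t' a b k' s' m') (htt : |t - t'| < 4) :
    t = t' ∨ 2 ≤ |t - t'| := by
  obtain ⟨h1, h2, h3, h4⟩ := h
  obtain ⟨h1', h2', h3', h4'⟩ := h'
  obtain ⟨hl, hr⟩ := abs_lt.1 htt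
  rw [le_abs]
  obtain ⟨K, hK⟩ : ∃ K : ℤ, k = k' + K := ⟨k - k', by ring⟩
  subst hK
  push_cast at h4
  -- The bound `|t - t'| < 4` leaves only the same or an adjacent period.
  have hK : K = -1 ∨ K = 0 ∨ K = 1 := by
    have a1 : 6 * (k' : ℝ) - 1 / 2 ≤ t' ∧ t' ≤ 6 * k' + 11 / 2 := by
      rcases h4' with ⟨h | ⟨-, h⟩, -⟩ | ⟨h | ⟨-, h⟩, -⟩ | ⟨h | ⟨-, h⟩, -⟩ <;>
        constructor <;> linarith
    have a2 : 6 * ((k' : ℝ) + K) - 1 / 2 ≤ t ∧ t ≤ 6 * (k' + K) + 11 / 2 := by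
      rcases h4 with ⟨h | ⟨-, h⟩, -⟩ | ⟨h | ⟨-, h⟩, -⟩ | ⟨h | ⟨-, h⟩, -⟩ <;>
        constructor <;> linarith
    have b1 : (K : ℝ) < 2 := by linarith
    have b2 : (-2 : ℝ) < K := by linarith
    have b1 : K < 2 := by exact_mod_cast b1
    have b2 : -2 < K := by exact_mod_cast b2
    omega
  have hKr : (K : ℝ) = -1 ∨ (K : ℝ) = 0 ∨ (K : ℝ) = 1 := by
    rcases hK with rfl | rfl | rfl <;> norm_num
  generalize (K : ℝ) = κ at *
  rcases h4 with ⟨h5, ha, hb⟩ | ⟨h5, ha, hb⟩ | ⟨h5, ha, hb⟩ <;>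
    rcases h4' with ⟨h5', ha', hb'⟩ | ⟨h5', ha', hb'⟩ | ⟨h5', ha', hb'⟩ <;>
    have hm : m = m' := by linarith
  all_goals
    subst hm
    rcases h5 with h6 | ⟨hm, h6⟩ <;> rcases h5' with h6' | ⟨hm', h6'⟩ <;>
    rcases hKr with hκ | hκ | hκ <;> rw [hκ] at h6 <;>
    first
      | (exfalso; linarith)
      | (left; linarith)
      | (right; left; linarith)
      | (right; right; linarith)

theorem eq_or_two_le_of_tri_eq {t t' y y' : ℝ} (hy : y ∈ Set.Icc (0 : ℝ) 1)
    (hy' : y' ∈ Set.Icc (0 : ℝ) 1) (h0 : triFst t y = triFst t' y')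
    (h1 : triSnd t y = triSnd t' y') (htt : |t - t'| < 4) : t = t' ∨ 2 ≤ |t - t'| := by
  obtain ⟨k, s, m, h⟩ := exists_triAddress t hy
  obtain ⟨k', s', m', h'⟩ := exists_triAddress t' hy'
  rw [← h0, ← h1] at h'
  exact h.eq_or_two_le h' htt

theorem tri_mem (t : ℝ) {y : ℝ} (hy : y ∈ Set.Icc (0 : ℝ) 1) :
    -1 ≤ triFst t y ∧ -1 ≤ triSnd t y ∧ triFst t y + triSnd t y ≤ 1 := by
  obtain ⟨k, s, m, h1, h2, h3, ⟨-, h4, h5⟩ | ⟨-, h4, h5⟩ | ⟨-, h4, h5⟩⟩ := exists_triAddress t hy <;>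
    rw [h4, h5] <;> refine ⟨?_, ?_, ?_⟩ <;> linarith

theorem exists_depth {s m : ℝ} (h1 : 2 * |s| ≤ m) (h2 : m ≤ 1) :
    ∃ y ∈ Set.Icc (0 : ℝ) 1, 1 - y * (1 - 2 * |s|) = m := by
  rcases (h1.trans h2).eq_or_lt with h | h
  -- At a vertex, `|s| = 1 / 2`, the depth is `1` at every height.
  · exact ⟨0, by simp, by linarith⟩
  · refine ⟨(1 - m) / (1 - 2 * |s|), ⟨div_nonneg (by linarith) (by linarith), ?_⟩, ?_⟩
    · rw [div_le_one (by linarith)]; linarith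
    · rw [div_mul_cancel₀ _ (by linarith)]; ring

/-- The sector is chosen by which of `a`, `b`, `-a - b` is least; the depth and the lateral position
are then solved from the two coordinates. -/
theorem exists_tri_eq {a b : ℝ} (ha : -1 ≤ a) (hb : -1 ≤ b) (hab : a + b ≤ 1) :
    ∃ t, ∃ y ∈ Set.Icc (0 : ℝ) 1, triFst t y = a ∧ triSnd t y = b := by
  by_cases h0 : a ≤ b ∧ a ≤ -a - b
  · have hs : 2 * |(-a / 2 - b) / 3| ≤ -a := by
      have : |(-a / 2 - b) / 3| ≤ -a / 2 := abs_le.2 ⟨by linarith, by linarith⟩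
      linarith
    obtain ⟨y, hy, hm⟩ := exists_depth hs (by linarith)
    have := tri_zero (s := (-a / 2 - b) / 3) (by linarith) y
    rw [hm] at this
    exact ⟨_, y, hy, by rw [this.1]; ring, by rw [this.2]; ring⟩
  by_cases h1 : b ≤ a ∧ b ≤ -a - b
  · have hs : 2 * |(b / 2 + a) / 3| ≤ -b := by
      have : |(b / 2 + a) / 3| ≤ -b / 2 := abs_le.2 ⟨by linarith, by linarith⟩
      linarith
    obtain ⟨y, hy, hm⟩ := exists_depth hs (by linarith)
    have := tri_four (s := (b / 2 + a) / 3) (by linarith) y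
    rw [hm] at this
    exact ⟨_, y, hy, by rw [this.1]; ring, by rw [this.2]; ring⟩
  · have h2 : -a - b ≤ a ∧ -a - b ≤ b := by
      rw [not_and_or, not_le, not_le] at h0 h1
      rcases h0 with h0 | h0 <;> rcases h1 with h1 | h1 <;> constructor <;> linarith
    have hs : 2 * |(b - a) / 6| ≤ a + b := by
      have : |(b - a) / 6| ≤ (a + b) / 2 := abs_le.2 ⟨by linarith, by linarith⟩
      linarith
    obtain ⟨y, hy, hm⟩ := exists_depth hs hab
    have := tri_two (s := (b - a) / 6) (by linarith) y
    rw [hm] at this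
    exact ⟨_, y, hy, by rw [this.1]; ring, by rw [this.2]; ring⟩

/-- On the ray from the center to a vertex, the two adjacent sectors have mirror-symmetric times. -/
theorem tri_mirror {g : ℝ} (hg : g ∈ Set.Icc (0 : ℝ) (1 / 2)) :
    triFst (g + 2) 1 = triFst (-g) 1 ∧ triSnd (g + 2) 1 = triSnd (-g) 1 := by
  have e : |g| = g := abs_of_nonneg hg.1
  have h1 := tri_two (s := g) (by rw [e]; exact hg.2) 1
  have h2 := tri_zero (s := -g) (by rw [abs_neg, e]; exact hg.2) 1
  rw [abs_neg, e] at h2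
  rw [e] at h1
  rw [add_comm, h1.1, h1.2, h2.1, h2.2]
  constructor <;> ring

/-! ### The closed curve and its time lags. -/

/-- A closed curve of period `6` that fills a convex set and whose self-intersections occur
exactly at the time lags in `(0, 2l] ∪ [2 - 2l, 3]`. -/
theorem exists_convex_filling_loop {l : ℝ} (hl : 0 < l) (hl2 : l < 1 / 2) :
    ∃ x y : ℝ → ℝ, Continuous x ∧ Continuous y ∧ Function.Periodic x 6 ∧ Function.Periodic y 6 ∧
      (∀ t t', x t = x t' → y t = y t' → |t - t'| ≤ 3 → |t - t'| ≤ 2 * l ∨ 2 - 2 * l ≤ |t - t'|) ∧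
      (∀ c ∈ Set.Ioc 0 (2 * l) ∪ Set.Icc (2 - 2 * l) 3, ∃ t, x (t + c) = x t ∧ y (t + c) = y t) ∧
      ∀ t t', ∃ u, x u = (x t + x t') / 2 ∧ y u = (y t + y t') / 2 := by
  obtain ⟨G, Y, hG, hYc, hper, hY, hclose, hfill, hrest, hsym⟩ := exists_strip_filling_curve hl hl2
  have hside := continuous_sideCoord
  have hhex := continuous_hexTent
  have hper6 : ∀ t, G (t + 6) = G t + 6 * (1 : ℤ) ∧ Y (t + 6) = Y t := fun t => by
    have := hper 3 t
    push_cast at this ⊢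
    norm_num at this ⊢
    exact this
  have hper2 : ∀ t, G (t + 2) = G t + 2 ∧ Y (t + 2) = Y t := fun t => by
    have := hper 1 t
    push_cast at this
    norm_num at this
    exact this
  refine ⟨fun t => triFst (G t) (Y t), fun t => triSnd (G t) (Y t), by unfold triFst; fun_prop,
    by unfold triSnd; fun_prop, fun t => ?_, fun t => ?_, fun t t' h0 h1 htt => ?_, ?_,
    fun t t' => ?_⟩
  · simp only [(hper6 t).1, (hper6 t).2, triFst_add]
  · simp only [(hper6 t).1, (hper6 t).2, triSnd_add]
  · have a1 := abs_le.1 (hclose t)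
    have a2 := abs_le.1 (hclose t')
    have a3 := abs_le.1 htt
    have hlt : |G t - G t'| < 4 := abs_lt.2 ⟨by linarith, by linarith⟩
    rcases eq_or_two_le_of_tri_eq (hY t) (hY t') h0 h1 hlt with h | h
    · left; rw [abs_le]; constructor <;> linarith
    · right
      rw [le_abs] at h ⊢
      rcases h with h | h
      · left; linarith
      · right; linarith
  -- The center is visited over both `0` and `2`, so two resting times around `0` give a coincidence
  -- after one of them is shifted by `2`.
  · have htwo : ∀ t t', G t = 0 ∧ Y t = 1 → G t' = 0 ∧ Y t' = 1 →
        triFst (G (t + 2)) (Y (t + 2)) = triFst (G t') (Y t') ∧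
        triSnd (G (t + 2)) (Y (t + 2)) = triSnd (G t') (Y t') := by
      intro t t' ⟨h1, h2⟩ ⟨h3, h4⟩
      have := tri_mirror (g := 0) (by norm_num)
      rw [neg_zero] at this
      rwa [(hper2 t).1, (hper2 t).2, h1, h2, h3, h4]
    rintro c (⟨hc0, hc1⟩ | ⟨hc0, hc1⟩)
    · obtain ⟨t, h1, h2⟩ : ∃ t, (G t = 0 ∧ Y t = 1) ∧ G (t + c) = 0 ∧ Y (t + c) = 1 := by
        -- The resting times form the two intervals `±[l / 3, l]`: differences up to `2 * l / 3` are
        -- found inside one of them, larger ones up to `2 * l` between the two.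
        rcases le_total c (2 * l / 3) with h | h
        · exact ⟨l - c, hrest _ (by rw [abs_of_nonneg] <;> linarith)
            (by rw [abs_of_nonneg] <;> linarith), hrest _ (by rw [abs_of_nonneg] <;> linarith)
            (by rw [abs_of_nonneg] <;> linarith)⟩
        · exact ⟨-(c / 2), hrest _ (by rw [abs_of_nonpos] <;> linarith)
            (by rw [abs_of_nonpos] <;> linarith), hrest _ (by rw [abs_of_nonneg] <;> linarith)
            (by rw [abs_of_nonneg] <;> linarith)⟩
      exact ⟨t, by simp only [h1.1, h1.2, h2.1, h2.2], by simp only [h1.1, h1.2, h2.1, h2.2]⟩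
    · rcases le_total c 2 with h | h
      · obtain ⟨t, h1, h2⟩ : ∃ t, (G t = 0 ∧ Y t = 1) ∧ G (t + c - 2) = 0 ∧ Y (t + c - 2) = 1 := by
          rcases le_total ((2 - c) / 2) (l / 3) with h' | h'
          · exact ⟨(2 - c) / 2 - 2 * l / 3, hrest _ (by rw [abs_of_nonpos] <;> linarith)
              (by rw [abs_of_nonpos] <;> linarith), hrest _ (by rw [abs_of_nonpos] <;> linarith)
              (by rw [abs_of_nonpos] <;> linarith)⟩
          · exact ⟨(2 - c) / 2, hrest _ (by rw [abs_of_nonneg] <;> linarith)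
              (by rw [abs_of_nonneg] <;> linarith), hrest _ (by rw [abs_of_nonpos] <;> linarith)
              (by rw [abs_of_nonpos] <;> linarith)⟩
        have := htwo _ _ h2 h1
        rw [sub_add_cancel] at this
        exact ⟨t, this⟩
      -- With `α = (c - 2) / 2`, the times `-b` and `a + 2` differ by `a + b + 2 = c` and lie over
      -- `-g` and `g + 2`, which are mirror images across a ray.
      · obtain ⟨a, b, g, hab, hg, h1, h2, h3, h4⟩ :=
          hsym ((c - 2) / 2) ⟨by linarith, by linarith⟩
        have := tri_mirror hg
        refine ⟨-b, ?_⟩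
        rw [show -b + c = a + 2 by linarith]
        simp only [(hper2 a).1, (hper2 a).2, h1, h2, h3, h4]
        exact this
  · obtain ⟨a1, a2, a3⟩ := tri_mem (G t) (hY t)
    obtain ⟨b1, b2, b3⟩ := tri_mem (G t') (hY t')
    obtain ⟨g, y, hy, h1, h2⟩ := exists_tri_eq
      (a := (triFst (G t) (Y t) + triFst (G t') (Y t')) / 2)
      (b := (triSnd (G t) (Y t) + triSnd (G t') (Y t')) / 2)
      (by linarith) (by linarith) (by linarith)
    obtain ⟨u, hu1, hu2⟩ := hfill g y hy
    exact ⟨u, by simp only [hu1, hu2, h1], by simp only [hu1, hu2, h2]⟩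

/-! ### Transfer to the circle and conclusion. -/

/-- The polar angle of the points of a circle. -/
theorem exists_polar_angle (c : EuclideanSpace ℝ (Fin 2)) {r : ℝ} (hr : 0 < r) :
    ∃ Φ : Metric.sphere c r → Real.Angle, Continuous Φ ∧ Function.Bijective Φ ∧
      ∀ a b, angularDist c r a b = |(Φ a - Φ b).toReal| := by
  set e := Complex.orthonormalBasisOneI.repr with he
  have hnorm : ∀ a : Metric.sphere c r, ‖e.symm (a - c)‖ = r := fun a => by
    rw [LinearIsometryEquiv.norm_map, ← dist_eq_norm]; exact a.2
  have hne : ∀ a : Metric.sphere c r, e.symm (a - c) ≠ 0 := fun a h => by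
    have := hnorm a
    rw [h, norm_zero] at this
    exact hr.ne this
  refine ⟨fun a => (Complex.arg (e.symm (a - c)) : Real.Angle), ?_, ⟨?_, ?_⟩, fun a b => ?_⟩
  · refine continuous_iff_continuousAt.2 fun a => ?_
    have h1 := Complex.continuousAt_arg_coe_angle (hne a)
    have h2 : Continuous fun a : Metric.sphere c r => e.symm ((a : EuclideanSpace ℝ (Fin 2)) - c) := by
      fun_prop
    exact ContinuousAt.comp (f := fun a : Metric.sphere c r =>
      e.symm ((a : EuclideanSpace ℝ (Fin 2)) - c)) h1 h2.continuousAt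
  · intro a b hab
    have h := Complex.arg_coe_angle_eq_iff.1 hab
    have := Complex.ext_norm_arg ((hnorm a).trans (hnorm b).symm) h
    exact Subtype.ext (sub_left_injective (e.symm.injective this))
  · intro θ
    refine ⟨⟨c + e (r * Complex.exp (θ.toReal * Complex.I)), ?_⟩, ?_⟩
    · rw [mem_sphere_iff_norm, add_sub_cancel_left, LinearIsometryEquiv.norm_map, norm_mul,
        Complex.norm_exp_ofReal_mul_I, mul_one, Complex.norm_real, Real.norm_of_nonneg hr.le]
    · simp only [add_sub_cancel_left, LinearIsometryEquiv.symm_apply_apply]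
      have := Complex.arg_mul_cos_add_sin_mul_I_coe_angle hr (θ.toReal : Real.Angle)
      rw [Real.Angle.cos_coe, Real.Angle.sin_coe, Complex.ofReal_cos, Complex.ofReal_sin,
        Real.Angle.coe_toReal] at this
      rw [Complex.exp_mul_I, this]
  · rw [← Complex.arg_div_coe_angle (hne a) (hne b), Complex.arg_coe_angle_toReal_eq_arg,
      ← Complex.angle_eq_abs_arg (hne a) (hne b), angularDist, EuclideanGeometry.angle]
    exact (e.symm.toLinearIsometry.angle_map _ _).symm

/-- The midpoint lies both on the segment and in the image, so for visual neighbors it must be an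
endpoint, which makes the segment degenerate. -/
theorem eq_of_areVisualNeighbors {M : Type*} {m : ℕ} {f : M → EuclideanSpace ℝ (Fin m)}
    (hf : ∀ a b, midpoint ℝ (f a) (f b) ∈ Set.range f) {a b : M} (h : AreVisualNeighbors f a b) :
    f a = f b := by
  rcases h.2 with h | h
  · exact h
  · have : midpoint ℝ (f a) (f b) ∈ ({f a, f b} : Set _) :=
      h ▸ ⟨midpoint_mem_segment _ _, hf a b⟩
    rcases this with h | h
    · exact (midpoint_eq_left_iff ℝ).1 h
    · exact (midpoint_eq_right_iff ℝ).1 h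

theorem mainTheorem6 (c : EuclideanSpace ℝ (Fin 2)) (r : ℝ) (hr : 0 < r)
    (ε : ℝ) (hε : ε ∈ Set.Ioo 0 (Real.pi / 3)) :
    ∃ f : Metric.sphere c r → EuclideanSpace ℝ (Fin 2),
      Continuous f ∧
        visualDistances (angularDist c r) f =
          Set.Ioc 0 ε ∪ Set.Icc (2 * Real.pi / 3 - ε) Real.pi := by
  have hπ := Real.pi_pos
  obtain ⟨hε0, hε1⟩ := hε
  -- Unit of angle: period `2π` becomes `6`, the maximal distance `π` becomes `3`, and `ε < q` is
  -- what gives `l < 1 / 2`.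
  set q : ℝ := Real.pi / 3 with hq
  have hq0 : 0 < q := by positivity
  have hl2 : ε / (2 * q) < 1 / 2 := by rw [div_lt_iff₀ (by positivity)]; linarith
  obtain ⟨x, y, hx, hy, hxp, hyp, hsub, hreal, hmid⟩ :=
    exists_convex_filling_loop (l := ε / (2 * q)) (by positivity) hl2
  have hlε : 2 * (ε / (2 * q)) = ε / q := by field_simp
  rw [hlε] at hsub hreal
  obtain ⟨Φ, hΦ, hΦb, hdist⟩ := exists_polar_angle c hr
  set F : ℝ → EuclideanSpace ℝ (Fin 2) := fun θ => !₂[x (θ / q), y (θ / q)] with hF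
  have hFc : Continuous F := by
    rw [hF]; fun_prop
  have hFp : Function.Periodic F (2 * Real.pi) := fun θ => by
    have : (θ + 2 * Real.pi) / q = θ / q + 6 := by rw [hq]; field_simp; ring
    simp only [hF, this, hxp (θ / q), hyp (θ / q)]
  have hFinj : ∀ s t, F (q * s) = F (q * t) ↔ x s = x t ∧ y s = y t := by
    intro s t
    simp only [hF, mul_div_cancel_left₀ _ hq0.ne']
    constructor
    · intro h
      exact ⟨by simpa using congrArg (fun p : EuclideanSpace ℝ (Fin 2) => p 0) h,
        by simpa using congrArg (fun p : EuclideanSpace ℝ (Fin 2) => p 1) h⟩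
    · rintro ⟨h1, h2⟩; rw [h1, h2]
  set L : Real.Angle → EuclideanSpace ℝ (Fin 2) := hFp.lift with hL
  have hLc : Continuous L := continuous_coinduced_dom.2 hFc
  have hLF : ∀ θ : ℝ, L (θ : Real.Angle) = F θ := fun θ => hFp.lift_coe θ
  have hmidF : ∀ a b, midpoint ℝ (L (Φ a)) (L (Φ b)) ∈ Set.range fun a => L (Φ a) := by
    intro a b
    obtain ⟨u, hu1, hu2⟩ := hmid ((Φ a).toReal / q) ((Φ b).toReal / q)
    obtain ⟨p, hp⟩ := hΦb.2 ((q * u : ℝ) : Real.Angle)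
    refine ⟨p, ?_⟩
    simp only [hp]
    rw [← Real.Angle.coe_toReal (Φ a), ← Real.Angle.coe_toReal (Φ b), hLF, hLF, hLF,
      midpoint_eq_smul_add]
    simp only [hF, mul_div_cancel_left₀ _ hq0.ne', hu1, hu2]
    ext i
    fin_cases i <;> simp <;> ring
  refine ⟨fun a => L (Φ a), hLc.comp hΦ, ?_⟩
  have h2q : 2 * Real.pi / 3 = 2 * q := by rw [hq]; ring
  have h3q : Real.pi = 3 * q := by rw [hq]; ring
  ext d
  constructor
  · rintro ⟨a, b, hab, rfl⟩
    have heq := eq_of_areVisualNeighbors hmidF hab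
    have hne : (Φ a - Φ b).toReal ≠ 0 := by
      rw [Ne, Real.Angle.toReal_eq_zero_iff, sub_eq_zero]
      exact fun h => hab.1 (hΦb.1 h)
    have hle := Real.Angle.abs_toReal_le_pi (Φ a - Φ b)
    rw [hdist]
    set D := (Φ a - Φ b).toReal with hD
    have hs : L (Φ a) = F (q * (((Φ b).toReal + D) / q)) := by
      rw [mul_div_cancel₀ _ hq0.ne', ← hLF, Real.Angle.coe_add, hD, Real.Angle.coe_toReal,
        Real.Angle.coe_toReal, add_sub_cancel]
    have ht : L (Φ b) = F (q * ((Φ b).toReal / q)) := by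
      rw [mul_div_cancel₀ _ hq0.ne', ← hLF, Real.Angle.coe_toReal]
    simp only [hs, ht, hFinj] at heq
    have e : |((Φ b).toReal + D) / q - (Φ b).toReal / q| = |D| / q := by
      rw [← sub_div, add_sub_cancel_left, abs_div, abs_of_pos hq0]
    have := hsub _ _ heq.1 heq.2
    rw [e] at this
    rcases this (by rw [div_le_iff₀ hq0]; linarith) with h | h
    · left
      exact ⟨abs_pos.2 hne, (div_le_div_iff_of_pos_right hq0).1 h⟩
    · right
      refine ⟨?_, hle⟩
      rw [le_div_iff₀ hq0, sub_mul, div_mul_cancel₀ _ hq0.ne'] at h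
      rwa [h2q]
  · intro hd
    have hd0 : 0 < d := by
      rcases hd with h | h
      · exact h.1
      · have := h.1; linarith
    have hdπ : d ≤ Real.pi := by
      rcases hd with h | h
      · have := h.2; linarith
      · exact h.2
    have hc : d / q ∈ Set.Ioc 0 (ε / q) ∪ Set.Icc (2 - ε / q) 3 := by
      rcases hd with h | h
      · exact Or.inl ⟨by positivity, (div_le_div_iff_of_pos_right hq0).2 h.2⟩
      · refine Or.inr ⟨?_, by rw [div_le_iff₀ hq0]; linarith⟩
        rw [le_div_iff₀ hq0, sub_mul, div_mul_cancel₀ _ hq0.ne', ← h2q]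
        exact h.1
    obtain ⟨t, ht⟩ := hreal _ hc
    obtain ⟨a, ha⟩ := hΦb.2 ((q * (t + d / q) : ℝ) : Real.Angle)
    obtain ⟨b, hb⟩ := hΦb.2 ((q * t : ℝ) : Real.Angle)
    have hdab : angularDist c r a b = d := by
      rw [hdist, ha, hb, ← Real.Angle.coe_sub,
        show q * (t + d / q) - q * t = d by field_simp; ring,
        Real.Angle.toReal_coe_eq_self_iff.2 ⟨by linarith, hdπ⟩, abs_of_pos hd0]
    refine ⟨a, b, ⟨?_, Or.inl ?_⟩, hdab⟩
    · rintro rfl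
      rw [hdist, sub_self, Real.Angle.toReal_zero, abs_zero] at hdab
      exact hd0.ne hdab
    · simp only [ha, hb, hLF]
      exact (hFinj _ _).2 ht
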